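/- Let $L\ge N\ge 2$ be integers and let $m>0$, $b>0$, $a>0$, $h\ge 0$ and $\theta$ be real numbers. Place $N$ point masses, each equal to $m$, at the vertices of a regular $N$-gon, $$q_k=\Big(\cos\tfrac{2\pi k}{N},\ \sin\tfrac{2\pi k}{N},\ 0\Big),\qquad 1\le k\le N,$$ and $L$ point masses, each equal to $bm$, at the vertices of a regular $L$-gon, $$\tilde q_l=\Big(a\cos\big(\tfrac{2\pi l}{L}+\theta\big),\ a\sin\big(\tfrac{2\pi l}{L}+\theta\big),\ h\Big),\qquad 1\le l\le L$$ (a regular $2$-gon is a pair of antipodal points). Let $P_k$ and $\tilde P_l$ be the positions of these $N+L$ bodies relative to their common centre of mass. Bodies with masses $m_i>0$ at positions $x_i\in\mathbb R^3$ with $\sum_i m_ix_i=0$ form a central configuration if the $x_i$ are pairwise distinct and there is $\lambda\in\mathbb R$ such that $$\sum_{j\ne i}\frac{m_jm_i}{|x_j-x_i|^3}(x_j-x_i)=-\lambda\, m_i\,x_i\qquad\text{for all } i.$$ If $P_1,\dots,P_N,\tilde P_1,\dots,\tilde P_L$ form a central configuration, then $N=L$, and moreover $\theta\equiv 0$ or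 $\theta\equiv \pi/N \pmod{2\pi/N}$. -/

import Mathlib

/-- Newtonian central configurations of finitely many bodies in `ℝ³`, with masses `m` and
positions `q`: the centre of mass is at the origin, no two bodies collide, and for some real
constant `lam` the equations
`∑_{j ≠ k} m_j m_k / |q_j - q_k|³ (q_j - q_k) = - lam m_k q_k` hold for all `k`. -/
def IsCentralConfiguration {ι : Type*} [Fintype ι] [DecidableEq ι] (m : ι → ℝ)
    (q : ι → EuclideanSpace ℝ (Fin 3)) : Prop :=
  ∑ i, m i • q i = 0 ∧
  (∀ j k, j ≠ k → q j ≠ q k) ∧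
  ∃ lam : ℝ, ∀ k, ∑ j ∈ Finset.univ.erase k,
    (m j * m k / ‖q j - q k‖ ^ 3) • (q j - q k) = -(lam * m k) • q k

/-- The masses of the `N + L` bodies: each of the `N` lower ones has mass `m`, each of the `L`
upper ones has mass `b m`. -/
def twoPolygonMass (N L : ℕ) (m b : ℝ) : Fin N ⊕ Fin L → ℝ
  | Sum.inl _ => m
  | Sum.inr _ => b * m

/-- The vertices of the two polygons: the lower regular `N`-gon is inscribed in the unit circle of
the plane `z = 0`; the upper regular `L`-gon is inscribed in the circle of radius `a` about the
`z`-axis in the plane `z = h` and is turned by the angle `θ`. -/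
noncomputable def twoPolygonVertex (N L : ℕ) (a h θ : ℝ) :
    Fin N ⊕ Fin L → EuclideanSpace ℝ (Fin 3)
  | Sum.inl k => !₂[Real.cos (2 * Real.pi * k / N), Real.sin (2 * Real.pi * k / N), 0]
  | Sum.inr l => !₂[a * Real.cos (2 * Real.pi * l / L + θ),
      a * Real.sin (2 * Real.pi * l / L + θ), h]

/-- The positions of the bodies relative to their centre of mass. -/
noncomputable def twoPolygonConfig (N L : ℕ) (m b a h θ : ℝ) :
    Fin N ⊕ Fin L → EuclideanSpace ℝ (Fin 3) :=
  fun i => twoPolygonVertex N L a h θ i -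
    Finset.univ.centerMass (twoPolygonMass N L m b) (twoPolygonVertex N L a h θ)

/-!
The integral `∫₀^∞ (t² + ρ²)⁻ᵏ⁻¹ dt` is a positive multiple of `ρ⁻²ᵏ⁻¹`, and if `ρ` is the distance
of two points on coaxial circles, then `t² + ρ²` is a positive multiple of `cosh u - cos x`, where
`x` is the difference of their polar angles and `u > 0` does not depend on `x`. The sums over a
regular `n`-gon turned by `φ` that arise under the integral come from the logarithmic derivative of
`∏ 2 (cosh u - cos (φ + 2 π k / n)) = 2 (cosh (n u) - cos (n φ))`, hence are explicit.

The tangential force of the `n`-gon at relative angle `φ` turns out to be `sin (n φ)` times an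
integral of a positive function. It vanishes at all vertices of the other polygon, so each of the
numbers of vertices divides twice the other one. If one of them were twice the other, then the
polygon with more vertices would have some that see the other polygon aligned (`cos (n φ) = 1`) and
some that see it staggered (`cos (n φ) = -1`). But the axial force differs between these when the
planes of the polygons differ, and the radial force does when the planes coincide.
-/

open Real Finset MeasureTheory

/-! ### Superposition of Cauchy kernels -/

theorem integrable_inv_sq_add_sq_pow (k : ℕ) {d : ℝ} (hd : 0 < d) :
    Integrable fun x : ℝ => ((x ^ 2 + d ^ 2) ^ (k + 1))⁻¹ := by
  have unit : Integrable fun x : ℝ => ((x ^ 2 + 1) ^ (k + 1))⁻¹ := by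
    refine integrable_inv_one_add_sq.mono' (by fun_prop) (.of_forall fun x => ?_)
    rw [norm_of_nonneg (by positivity), add_comm]
    exact inv_anti₀ (by positivity) (le_self_pow₀ (by nlinarith) k.succ_ne_zero)
  convert! (unit.comp_mul_left' (inv_ne_zero hd.ne')).const_mul ((d ^ 2) ^ (k + 1))⁻¹ using 2 with x
  rw [← mul_inv, ← mul_pow]
  field_simp

theorem integral_inv_sq_add_sq_pow (k : ℕ) {d : ℝ} (hd : 0 < d) :
    ∫ x in Set.Ioi (0 : ℝ), ((x ^ 2 + d ^ 2) ^ (k + 1))⁻¹ =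
      (∫ x in Set.Ioi (0 : ℝ), ((x ^ 2 + 1) ^ (k + 1))⁻¹) / d ^ (2 * k + 1) := by
  have scale := integral_comp_mul_left_Ioi' (fun x => ((x ^ 2 + d ^ 2) ^ (k + 1))⁻¹) 0 hd
  rw [mul_zero] at scale
  rw [← scale, smul_eq_mul, ← integral_const_mul, ← integral_div]
  refine integral_congr_ae (.of_forall fun x => ?_)
  have h : (d * x) ^ 2 + d ^ 2 = d ^ 2 * (x ^ 2 + 1) := by ring
  beta_reduce
  rw [h, mul_pow]
  field_simp
  ring

theorem integral_sum_div_sq_add_sq_pow {ι : Type*} {s : Finset ι} (k : ℕ) {c d : ι → ℝ}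
    (hd : ∀ i ∈ s, 0 < d i) :
    ∫ x in Set.Ioi (0 : ℝ), ∑ i ∈ s, c i / (x ^ 2 + d i ^ 2) ^ (k + 1) =
      (∫ x in Set.Ioi (0 : ℝ), ((x ^ 2 + 1) ^ (k + 1))⁻¹) *
        ∑ i ∈ s, c i / d i ^ (2 * k + 1) := by
  simp only [div_eq_mul_inv]
  rw [integral_finsetSum _ fun i hi =>
    ((integrable_inv_sq_add_sq_pow k (hd i hi)).const_mul _).integrableOn, mul_sum]
  refine sum_congr rfl fun i hi => ?_
  rw [integral_const_mul, integral_inv_sq_add_sq_pow k (hd i hi)]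
  ring

theorem setIntegral_lt_setIntegral_of_forall_lt {α : Type*} [MeasurableSpace α] {μ : Measure α}
    {s : Set α} {f g : α → ℝ} (hs : MeasurableSet s) (hμ : μ s ≠ 0) (hf : IntegrableOn f s μ)
    (hg : IntegrableOn g s μ) (h : ∀ x ∈ s, f x < g x) :
    ∫ x in s, f x ∂μ < ∫ x in s, g x ∂μ := by
  rw [← sub_pos, ← integral_sub hg hf, setIntegral_pos_iff_support_of_nonneg_ae
    (ae_restrict_of_forall_mem hs fun x hx => (sub_pos.2 (h x hx)).le) (hg.sub hf)]
  exact (pos_iff_ne_zero.2 hμ).trans_le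
    (measure_mono fun x hx => ⟨(sub_pos.2 (h x hx)).ne', hx⟩)

/-- Since `d⁻⁽²ᵏ⁺¹⁾` is a positive multiple of `∫₀^∞ (x² + d²)⁻⁽ᵏ⁺¹⁾ dx`, an inequality between
combinations of odd inverse powers follows from the rational inequality under the integral. -/
theorem sum_div_pow_lt_of_sum_div_sq_add_sq_pow_lt {ι : Type*} {s : Finset ι} {k : ℕ}
    {c c' d d' : ι → ℝ} (hd : ∀ i ∈ s, 0 < d i) (hd' : ∀ i ∈ s, 0 < d' i)
    (h : ∀ x > 0, ∑ i ∈ s, c i / (x ^ 2 + d i ^ 2) ^ (k + 1) <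
      ∑ i ∈ s, c' i / (x ^ 2 + d' i ^ 2) ^ (k + 1)) :
    ∑ i ∈ s, c i / d i ^ (2 * k + 1) < ∑ i ∈ s, c' i / d' i ^ (2 * k + 1) := by
  have integrable {c d : ι → ℝ} (hd : ∀ i ∈ s, 0 < d i) :
      IntegrableOn (fun x => ∑ i ∈ s, c i / (x ^ 2 + d i ^ 2) ^ (k + 1)) (Set.Ioi 0) :=
    (integrable_finsetSum s fun i hi =>
      (integrable_inv_sq_add_sq_pow k (hd i hi)).const_mul (c i)).integrableOn
  have key := setIntegral_lt_setIntegral_of_forall_lt measurableSet_Ioi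
    (Measure.measure_Ioi_pos volume 0).ne' (integrable hd) (integrable hd') h
  rw [integral_sum_div_sq_add_sq_pow k hd, integral_sum_div_sq_add_sq_pow k hd'] at key
  exact lt_of_mul_lt_mul_left key (integral_nonneg fun x => by positivity)

/-! ### Sums over the vertices of a regular polygon -/

/-- The sum of `g` over the polar angles of the vertices of a regular `n`-gon whose first vertex
has polar angle `φ`. -/
noncomputable def polygonSum (n : ℕ) (g : ℝ → ℝ) (φ : ℝ) : ℝ :=
  ∑ k ∈ range n, g (φ + 2 * π * k / n)

theorem polygonSum_const_mul (n : ℕ) (c : ℝ) (g : ℝ → ℝ) (φ : ℝ) :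
    polygonSum n (fun x => c * g x) φ = c * polygonSum n g φ :=
  (mul_sum _ _ _).symm

theorem polygonSum_sub (n : ℕ) (f g : ℝ → ℝ) (φ : ℝ) :
    polygonSum n (fun x => f x - g x) φ = polygonSum n f φ - polygonSum n g φ :=
  sum_sub_distrib _ _

theorem sum_fin_eq_polygonSum (n : ℕ) (g : ℝ → ℝ) (α β : ℝ) :
    ∑ k : Fin n, g (2 * π * k / n + α - β) = polygonSum n g (α - β) := by
  rw [Fin.sum_univ_eq_sum_range fun k : ℕ => g (2 * π * k / n + α - β)]
  exact sum_congr rfl fun k _ => congrArg g (by ring)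

theorem polygonSum_periodic (n : ℕ) {g : ℝ → ℝ} (hg : Function.Periodic g (2 * π)) :
    Function.Periodic (polygonSum n g) (2 * π / n) := by
  intro φ
  rcases eq_or_ne n 0 with rfl | hn
  · simp [polygonSum]
  have hn' : (n : ℝ) ≠ 0 := Nat.cast_ne_zero.2 hn
  have shift (k : ℕ) : φ + 2 * π / n + 2 * π * k / n = φ + 2 * π * (k + 1 : ℕ) / n := by
    push_cast
    ring
  have wrap : g (φ + 2 * π * n / n) = g (φ + 2 * π * (0 : ℕ) / n) := by
    rw [mul_div_cancel_right₀ _ hn', hg]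
    simp
  simp only [polygonSum, shift]
  apply add_right_cancel (b := g (φ + 2 * π * (0 : ℕ) / n))
  rw [← sum_range_succ' fun k => g (φ + 2 * π * k / n), sum_range_succ, wrap]

theorem polygonSum_sub_mul_div (n : ℕ) {g : ℝ → ℝ} (hg : Function.Periodic g (2 * π)) (φ : ℝ)
    (j : ℕ) : polygonSum n g (φ - 2 * π * j / n) = polygonSum n g φ := by
  convert (polygonSum_periodic n hg).sub_nat_mul_eq j using 2
  ring

theorem polygonSum_zero_of_odd (n : ℕ) {g : ℝ → ℝ} (hg : Function.Periodic g (2 * π))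
    (hodd : g.Odd) : polygonSum n g 0 = 0 := by
  have reflect : polygonSum n g 0 = -polygonSum n g (0 - 2 * π * (n - 1 : ℕ) / n) := by
    simp only [polygonSum]
    rw [← sum_range_reflect, ← sum_neg_distrib]
    refine sum_congr rfl fun k hk => ?_
    rw [← hodd, Nat.cast_sub (Nat.le_sub_one_of_lt (mem_range.1 hk))]
    congr 1
    ring
  rw [polygonSum_sub_mul_div n hg] at reflect
  linarith

theorem polygonSum_cos {n : ℕ} (hn : 2 ≤ n) (φ : ℝ) : polygonSum n cos φ = 0 := by
  have hn' : (2 : ℝ) ≤ n := by exact_mod_cast hn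
  have sin_ne : sin (2 * π / n / 2) ≠ 0 := by
    refine (sin_pos_of_pos_of_lt_pi (by positivity) ?_).ne'
    rw [div_div, div_lt_iff₀ (by positivity)]
    nlinarith [pi_pos]
  have h := sin_mul_sum_cos n (2 * π / n) φ
  rw [show n * (2 * π / n) / 2 = π by field_simp, sin_pi, zero_mul] at h
  rw [← (mul_eq_zero.1 h).resolve_left sin_ne]
  exact sum_congr rfl fun k _ => congrArg cos (by ring)

/-! ### Trigonometric sums over a regular polygon -/

theorem cosh_sub_cos_pos {u : ℝ} (hu : 0 < u) (x : ℝ) : 0 < cosh u - cos x :=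
  sub_pos.2 ((cos_le_one x).trans_lt (one_lt_cosh.2 hu.ne'))

theorem normSq_exp_sub_exp_mul_I (u x : ℝ) :
    Complex.normSq (Complex.exp u - Complex.exp (x * Complex.I)) =
      exp u * (2 * (cosh u - cos x)) := by
  have h : exp u * exp (-u) = 1 := by rw [← exp_add, add_neg_cancel, exp_zero]
  simp only [Complex.normSq_apply, Complex.sub_re, Complex.sub_im, Complex.exp_ofReal_re,
    Complex.exp_ofReal_im, Complex.exp_ofReal_mul_I_re, Complex.exp_ofReal_mul_I_im, cosh_eq]
  linear_combination sin_sq_add_cos_sq x - h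

/-- The squared modulus of `∏ (eᵘ - eⁱᵠ ζᵏ) = eⁿᵘ - eⁱⁿᵠ`, where `ζ` is a primitive `n`-th root of
unity. -/
theorem prod_two_mul_cosh_sub_cos {n : ℕ} (hn : n ≠ 0) (u φ : ℝ) :
    ∏ k ∈ range n, (2 * (cosh u - cos (φ + 2 * π * k / n))) =
      2 * (cosh (n * u) - cos (n * φ)) := by
  have : (n : ℂ) ≠ 0 := Nat.cast_ne_zero.2 hn
  have factor : ∏ k ∈ range n,
      (Complex.exp u - Complex.exp ((φ + 2 * π * k / n : ℝ) * Complex.I)) =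
      Complex.exp (n * u : ℝ) - Complex.exp ((n * φ : ℝ) * Complex.I) := by
    have h := congrArg (Polynomial.eval (Complex.exp u)) (X_pow_sub_C_eq_prod
      (Complex.isPrimitiveRoot_exp n hn) hn.bot_lt (α := Complex.exp (φ * Complex.I)) rfl)
    simp only [Polynomial.eval_prod, Polynomial.eval_sub, Polynomial.eval_pow, Polynomial.eval_X,
      Polynomial.eval_C, ← Complex.exp_nat_mul, ← Complex.exp_add] at h
    push_cast
    rw [mul_assoc (n : ℂ), h]
    refine prod_congr rfl fun k _ => ?_
    congr 2
    ring
  have h := congrArg Complex.normSq factor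
  simp only [map_prod, normSq_exp_sub_exp_mul_I, prod_mul_distrib, prod_const, card_range,
    ← exp_nat_mul] at h
  rw [prod_mul_distrib, prod_const, card_range]
  exact mul_left_cancel₀ (exp_pos _).ne' h

theorem hasDerivAt_cosh_natCast_mul (n : ℕ) (u : ℝ) :
    HasDerivAt (fun u : ℝ => cosh (n * u)) (n * sinh (n * u)) u := by
  simpa [mul_comm] using ((hasDerivAt_id u).const_mul (n : ℝ)).cosh

theorem hasDerivAt_sinh_natCast_mul (n : ℕ) (u : ℝ) :
    HasDerivAt (fun u : ℝ => sinh (n * u)) (n * cosh (n * u)) u := by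
  simpa [mul_comm] using ((hasDerivAt_id u).const_mul (n : ℝ)).sinh

section LogDerivative

variable {n : ℕ} (hn : n ≠ 0) {u : ℝ} (hu : 0 < u) (φ : ℝ)

include hn hu

theorem cosh_natCast_mul_sub_cos_pos (x : ℝ) : 0 < cosh (n * u) - cos x :=
  cosh_sub_cos_pos (by positivity) x

theorem polygonSum_sinh_div :
    polygonSum n (fun x => sinh u / (cosh u - cos x)) φ =
      n * sinh (n * u) / (cosh (n * u) - cos (n * φ)) := by
  have left := logDeriv_prod (s := range n) (x := u)
    (f := fun k v => 2 * (cosh v - cos (φ + 2 * π * k / n)))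
    (fun k _ => (mul_pos two_pos (cosh_sub_cos_pos hu _)).ne') (fun k _ => by fun_prop)
  have right := ((hasDerivAt_cosh_natCast_mul n u).sub_const (cos (n * φ))).deriv
  simp only [prod_two_mul_cosh_sub_cos hn, logDeriv_const_mul _ _ (two_ne_zero' ℝ)] at left
  simp only [logDeriv_apply, right, deriv_sub_const_fun, Real.deriv_cosh] at left
  exact left.symm

theorem polygonSum_sin_div :
    polygonSum n (fun x => sin x / (cosh u - cos x)) φ =
      n * sin (n * φ) / (cosh (n * u) - cos (n * φ)) := by
  have hcos (m c t : ℝ) : HasDerivAt (fun ψ => t - cos (m * ψ + c)) (m * sin (m * φ + c)) φ := by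
    simpa [mul_comm] using ((((hasDerivAt_id φ).const_mul m).add_const c).cos).const_sub t
  have left := logDeriv_prod (s := range n) (x := φ)
    (f := fun k ψ => 2 * (cosh u - cos (ψ + 2 * π * k / n)))
    (fun k _ => (mul_pos two_pos (cosh_sub_cos_pos hu _)).ne') (fun k _ => by fun_prop)
  have term (k : ℕ) := (hcos 1 (2 * π * k / n) (cosh u)).deriv
  have right := (hcos n 0 (cosh (n * u))).deriv
  simp only [one_mul, add_zero] at term right
  simp only [prod_two_mul_cosh_sub_cos hn, logDeriv_const_mul _ _ (two_ne_zero' ℝ)] at left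
  simp only [logDeriv_apply, term, right] at left
  exact left.symm

/-- The `u`-derivative of `polygonSum_sin_div`. -/
theorem polygonSum_sin_div_sq :
    polygonSum n (fun x => sin x / (cosh u - cos x) ^ 2) φ =
      n ^ 2 * sinh (n * u) * sin (n * φ) / (sinh u * (cosh (n * u) - cos (n * φ)) ^ 2) := by
  have left : HasDerivAt (fun v => polygonSum n (fun x => sin x / (cosh v - cos x)) φ)
      (polygonSum n (fun x => -sinh u * (sin x / (cosh u - cos x) ^ 2)) φ) u :=
    HasDerivAt.fun_sum fun k _ => (((hasDerivAt_const u _).fun_div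
      ((hasDerivAt_cosh u).sub_const _) (cosh_sub_cos_pos hu _).ne')).congr_deriv (by ring)
  have hN := cosh_natCast_mul_sub_cos_pos hn hu (n * φ)
  have right := (hasDerivAt_const u (n * sin (n * φ))).fun_div
    ((hasDerivAt_cosh_natCast_mul n u).sub_const _) hN.ne'
  have h := left.unique (right.congr_of_eventuallyEq ((eventually_gt_nhds hu).mono
    fun v hv => polygonSum_sin_div hn hv φ))
  have hs := sinh_pos_iff.2 hu
  rw [polygonSum_const_mul] at h
  field_simp at h ⊢
  linear_combination -h

/-- The `u`-derivative of `polygonSum_sinh_div`. -/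
theorem polygonSum_cosh_div_sub :
    cosh u * polygonSum n (fun x => 1 / (cosh u - cos x)) φ -
      sinh u ^ 2 * polygonSum n (fun x => 1 / (cosh u - cos x) ^ 2) φ =
    n ^ 2 * (cosh (n * u) / (cosh (n * u) - cos (n * φ)) -
      sinh (n * u) ^ 2 / (cosh (n * u) - cos (n * φ)) ^ 2) := by
  have left : HasDerivAt (fun v => polygonSum n (fun x => sinh v / (cosh v - cos x)) φ)
      (polygonSum n (fun x => cosh u * (1 / (cosh u - cos x)) -
        sinh u ^ 2 * (1 / (cosh u - cos x) ^ 2)) φ) u := by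
    refine HasDerivAt.fun_sum fun k _ => ?_
    have h := cosh_sub_cos_pos hu (φ + 2 * π * k / n)
    refine ((hasDerivAt_sinh u).fun_div ((hasDerivAt_cosh u).sub_const _) h.ne').congr_deriv ?_
    field_simp
  have hN := cosh_natCast_mul_sub_cos_pos hn hu (n * φ)
  have right := ((hasDerivAt_sinh_natCast_mul n u).const_mul (n : ℝ)).fun_div
    ((hasDerivAt_cosh_natCast_mul n u).sub_const _) hN.ne'
  have h := left.unique (right.congr_of_eventuallyEq ((eventually_gt_nhds hu).mono
    fun v hv => polygonSum_sinh_div hn hv φ))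
  rw [polygonSum_sub, polygonSum_const_mul, polygonSum_const_mul] at h
  rw [h]
  field_simp

end LogDerivative

theorem tanh_natCast_mul_le (n : ℕ) {u : ℝ} (hu : 0 ≤ u) : tanh (n * u) ≤ n * tanh u := by
  rw [tanh_eq_sinh_div_cosh, tanh_eq_sinh_div_cosh, ← mul_div_assoc,
    div_le_div_iff₀ (cosh_pos _) (cosh_pos _)]
  induction n with
  | zero => simp
  | succ n ih =>
    have hs : 0 ≤ sinh u := sinh_nonneg_iff.2 hu
    have hS : 0 ≤ sinh (n * u) := sinh_nonneg_iff.2 (by positivity)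
    have add_one : ((n + 1 : ℕ) : ℝ) * u = n * u + u := by push_cast; ring
    have gain : 0 ≤ (n * sinh u * sinh (n * u)) * sinh u := by positivity
    rw [add_one, sinh_add, cosh_add]
    push_cast
    nlinarith [mul_le_mul_of_nonneg_right ih (cosh_pos u).le, cosh_sq u, mul_nonneg hS hs]

/-! ### Aligned and staggered regular polygons -/

section AlignedStaggered

variable {n : ℕ} (hn : n ≠ 0) {u : ℝ} (hu : 0 < u) {φ φ' : ℝ} (hφ : cos (n * φ) = 1)
  (hφ' : cos (n * φ') = -1)

include hn hu hφ hφ'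

theorem polygonSum_inv_cosh_sub_cos_sub :
    polygonSum n (fun x => 1 / (cosh u - cos x)) φ -
      polygonSum n (fun x => 1 / (cosh u - cos x)) φ' = 2 * n / (sinh u * sinh (n * u)) := by
  have aligned := polygonSum_sinh_div hn hu φ
  have staggered := polygonSum_sinh_div hn hu φ'
  have : 0 < sinh u := sinh_pos_iff.2 hu
  have : 0 < sinh (n * u) := sinh_pos_iff.2 (by positivity)
  have h1 := cosh_natCast_mul_sub_cos_pos hn hu (n * φ)
  have h2 := cosh_natCast_mul_sub_cos_pos hn hu (n * φ')
  simp only [← mul_one_div (sinh u), polygonSum_const_mul] at aligned staggered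
  rw [hφ] at aligned h1
  rw [hφ'] at staggered h2
  rw [eq_div_iff (by positivity), ← mul_assoc, mul_comm (_ - _), mul_sub, aligned, staggered]
  field_simp
  linear_combination -2 * cosh_sq (n * u)

theorem polygonSum_inv_cosh_sub_cos_lt :
    polygonSum n (fun x => 1 / (cosh u - cos x)) φ' <
      polygonSum n (fun x => 1 / (cosh u - cos x)) φ := by
  have : 0 < sinh u := sinh_pos_iff.2 hu
  have : 0 < sinh (n * u) := sinh_pos_iff.2 (by positivity)
  rw [← sub_pos, polygonSum_inv_cosh_sub_cos_sub hn hu hφ hφ']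
  positivity

theorem two_mul_cosh_mul_polygonSum_sub_le :
    2 * cosh u * (polygonSum n (fun x => 1 / (cosh u - cos x)) φ -
      polygonSum n (fun x => 1 / (cosh u - cos x)) φ') ≤
    sinh u ^ 2 * (polygonSum n (fun x => 1 / (cosh u - cos x) ^ 2) φ -
      polygonSum n (fun x => 1 / (cosh u - cos x) ^ 2) φ') := by
  have aligned := polygonSum_cosh_div_sub hn hu φ
  have staggered := polygonSum_cosh_div_sub hn hu φ'
  have first := polygonSum_inv_cosh_sub_cos_sub hn hu hφ hφ'
  have hs : 0 < sinh u := sinh_pos_iff.2 hu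
  have hS : 0 < sinh (n * u) := sinh_pos_iff.2 (by positivity)
  have h1 := cosh_natCast_mul_sub_cos_pos hn hu (n * φ)
  have h2 := cosh_natCast_mul_sub_cos_pos hn hu (n * φ')
  rw [hφ] at aligned h1
  rw [hφ'] at staggered h2
  have right_sub : n ^ 2 * (cosh (n * u) / (cosh (n * u) - 1) -
        sinh (n * u) ^ 2 / (cosh (n * u) - 1) ^ 2) -
      n ^ 2 * (cosh (n * u) / (cosh (n * u) - -1) -
        sinh (n * u) ^ 2 / (cosh (n * u) - -1) ^ 2) =
      -(2 * n ^ 2 * cosh (n * u) / sinh (n * u) ^ 2) := by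
    have sinh_sq' : sinh (n * u) ^ 2 = (cosh (n * u) - 1) * (cosh (n * u) - -1) := by
      linear_combination -cosh_sq (n * u)
    rw [sinh_sq']
    field_simp
    ring
  have bound : cosh u * (2 * n / (sinh u * sinh (n * u))) ≤
      2 * n ^ 2 * cosh (n * u) / sinh (n * u) ^ 2 := by
    rw [← mul_div_assoc, div_le_div_iff₀ (by positivity) (by positivity)]
    have tanh_le := tanh_natCast_mul_le n hu.le
    rw [tanh_eq_sinh_div_cosh, tanh_eq_sinh_div_cosh, ← mul_div_assoc,
      div_le_div_iff₀ (cosh_pos _) (cosh_pos _)] at tanh_le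
    have := mul_le_mul_of_nonneg_left tanh_le (by positivity : 0 ≤ 2 * n * sinh (n * u))
    linarith
  rw [← first] at bound
  linarith

theorem polygonSum_inv_cosh_sub_cos_sq_lt :
    polygonSum n (fun x => 1 / (cosh u - cos x) ^ 2) φ' <
      polygonSum n (fun x => 1 / (cosh u - cos x) ^ 2) φ := by
  have first := sub_pos.2 (polygonSum_inv_cosh_sub_cos_lt hn hu hφ hφ')
  have : 0 < cosh u := cosh_pos u
  have key : 0 < sinh u ^ 2 * _ :=
    (by positivity : (0 : ℝ) < _).trans_le (two_mul_cosh_mul_polygonSum_sub_le hn hu hφ hφ')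
  exact sub_pos.1 (pos_of_mul_pos_right key (sq_nonneg _))

theorem polygonSum_radial_kernel_lt {r s : ℝ} (hr : 0 < r) (hsr : s < r) :
    polygonSum n (fun x => (r * cos x - s) / (cosh u - cos x) ^ 2) φ' <
      polygonSum n (fun x => (r * cos x - s) / (cosh u - cos x) ^ 2) φ := by
  have expand (ψ : ℝ) : polygonSum n (fun x => (r * cos x - s) / (cosh u - cos x) ^ 2) ψ =
      (r * cosh u - s) * polygonSum n (fun x => 1 / (cosh u - cos x) ^ 2) ψ -
        r * polygonSum n (fun x => 1 / (cosh u - cos x)) ψ := by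
    rw [← polygonSum_const_mul, ← polygonSum_const_mul, ← polygonSum_sub]
    congr 1 with x
    have := cosh_sub_cos_pos hu x
    field_simp
    ring
  have first_le := two_mul_cosh_mul_polygonSum_sub_le hn hu hφ hφ'
  have second_pos := sub_pos.2 (polygonSum_inv_cosh_sub_cos_sq_lt hn hu hφ hφ')
  rw [expand, expand]
  set first := polygonSum n fun x => 1 / (cosh u - cos x)
  set second := polygonSum n fun x => 1 / (cosh u - cos x) ^ 2
  have coeff : r * sinh u ^ 2 < 2 * cosh u * (r * cosh u - s) := by
    nlinarith [cosh_sq u, mul_nonneg hr.le (sq_nonneg (cosh u - 1)),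
      mul_pos (sub_pos.2 hsr) (cosh_pos u)]
  have key : 2 * cosh u * (r * (first φ - first φ')) <
      2 * cosh u * ((r * cosh u - s) * (second φ - second φ')) :=
    calc 2 * cosh u * (r * (first φ - first φ'))
        = r * (2 * cosh u * (first φ - first φ')) := by ring
      _ ≤ r * (sinh u ^ 2 * (second φ - second φ')) := by gcongr
      _ = r * sinh u ^ 2 * (second φ - second φ') := by ring
      _ < 2 * cosh u * (r * cosh u - s) * (second φ - second φ') := by gcongr
      _ = 2 * cosh u * ((r * cosh u - s) * (second φ - second φ')) := by ring
  have := lt_of_mul_lt_mul_left key (mul_pos two_pos (cosh_pos u)).le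
  linarith

end AlignedStaggered

/-! ### Newtonian sums over a ring -/

/-- The distance between the points with cylindrical coordinates `(r, α, z)` and
`(s, α + x, z + d)`. -/
noncomputable def cylDist (r s d x : ℝ) : ℝ := √((r - s * cos x) ^ 2 + (s * sin x) ^ 2 + d ^ 2)

theorem cylDist_sq (r s d x : ℝ) :
    cylDist r s d x ^ 2 = r ^ 2 + s ^ 2 + d ^ 2 - 2 * r * s * cos x := by
  rw [cylDist, sq_sqrt (by positivity)]
  linear_combination s ^ 2 * sin_sq_add_cos_sq x

theorem cylDist_nonneg (r s d x : ℝ) : 0 ≤ cylDist r s d x := sqrt_nonneg _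

theorem cylDist_periodic (r s d : ℝ) : Function.Periodic (cylDist r s d) (2 * π) := fun x => by
  rw [cylDist, cylDist, cos_add_two_pi, sin_add_two_pi]

theorem cylDist_neg (r s d x : ℝ) : cylDist r s d (-x) = cylDist r s d x := by
  rw [cylDist, cylDist, cos_neg, sin_neg, mul_neg, neg_sq]

section NewtonianSums

variable {r s d : ℝ} (hr : 0 < r) (hs : 0 < s)

include hr hs

theorem exists_sq_add_cylDist_sq_eq {t : ℝ} (ht : 0 < t) :
    ∃ u > 0, ∀ x, t ^ 2 + cylDist r s d x ^ 2 = 2 * r * s * (cosh u - cos x) := by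
  have one_lt : 1 < (t ^ 2 + r ^ 2 + s ^ 2 + d ^ 2) / (2 * r * s) := by
    rw [one_lt_div (by positivity)]
    nlinarith [sq_nonneg (r - s), sq_nonneg d]
  refine ⟨arcosh _, arcosh_pos one_lt, fun x => ?_⟩
  rw [cosh_arcosh one_lt.le, cylDist_sq]
  field_simp
  ring

variable {n : ℕ} {φ φ' : ℝ} (hpos : ∀ k < n, 0 < cylDist r s d (φ + 2 * π * k / n))

include hpos

theorem polygonSum_div_cylDist_pow_lt {j : ℕ} {c c' : ℝ → ℝ}
    (hpos' : ∀ k < n, 0 < cylDist r s d (φ' + 2 * π * k / n))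
    (h : ∀ u > 0, polygonSum n (fun x => c x / (cosh u - cos x) ^ (j + 1)) φ <
      polygonSum n (fun x => c' x / (cosh u - cos x) ^ (j + 1)) φ') :
    polygonSum n (fun x => c x / cylDist r s d x ^ (2 * j + 1)) φ <
      polygonSum n (fun x => c' x / cylDist r s d x ^ (2 * j + 1)) φ' := by
  refine sum_div_pow_lt_of_sum_div_sq_add_sq_pow_lt (fun k hk => hpos k (mem_range.1 hk))
    (fun k hk => hpos' k (mem_range.1 hk)) fun t ht => ?_
  obtain ⟨u, hu, dist_eq⟩ := exists_sq_add_cylDist_sq_eq (d := d) hr hs ht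
  simp only [dist_eq, mul_pow _ (cosh u - _), div_mul_eq_div_div_swap _ (_ ^ (j + 1)),
    ← sum_div]
  exact div_lt_div_of_pos_right (h u hu) (by positivity)

theorem sin_natCast_mul_eq_zero_of_polygonSum_eq_zero (hn : n ≠ 0)
    (h : polygonSum n (fun x => sin x / cylDist r s d x ^ 3) φ = 0) : sin (n * φ) = 0 := by
  by_contra hne
  have kernel_pos {u : ℝ} (hu : 0 < u) :
      0 < sin (n * φ) * polygonSum n (fun x => sin x / (cosh u - cos x) ^ 2) φ := by
    have : 0 < sinh (n * u) := sinh_pos_iff.2 (by positivity)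
    have : 0 < sinh u := sinh_pos_iff.2 hu
    have hN := cosh_natCast_mul_sub_cos_pos hn hu (n * φ)
    rw [polygonSum_sin_div_sq hn hu, ← mul_div_assoc, mul_comm (sin _), mul_assoc]
    exact div_pos (mul_pos (by positivity) (mul_self_pos.2 hne)) (by positivity)
  have pos := polygonSum_div_cylDist_pow_lt (j := 1) (c := fun x => 0 * sin x)
    (c' := fun x => sin (n * φ) * sin x) hr hs hpos hpos fun u hu => by
      simp only [mul_div_assoc, polygonSum_const_mul]
      exact (zero_mul _).trans_lt (kernel_pos hu)
  simp only [mul_div_assoc, polygonSum_const_mul] at pos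
  rw [h, mul_zero, mul_zero] at pos
  exact pos.false

variable (hpos' : ∀ k < n, 0 < cylDist r s d (φ' + 2 * π * k / n)) (hn : n ≠ 0)
  (hφ : cos (n * φ) = 1) (hφ' : cos (n * φ') = -1)

include hpos' hn hφ hφ'

theorem polygonSum_inv_cylDist_lt :
    polygonSum n (fun x => 1 / cylDist r s d x) φ' <
      polygonSum n (fun x => 1 / cylDist r s d x) φ := by
  simpa using polygonSum_div_cylDist_pow_lt (j := 0) (c := 1) (c' := 1) hr hs hpos' hpos
    fun u hu => by simpa using polygonSum_inv_cosh_sub_cos_lt hn hu hφ hφ'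

theorem polygonSum_inv_cylDist_cube_lt :
    polygonSum n (fun x => 1 / cylDist r s d x ^ 3) φ' <
      polygonSum n (fun x => 1 / cylDist r s d x ^ 3) φ :=
  polygonSum_div_cylDist_pow_lt (j := 1) (c := 1) (c' := 1) hr hs hpos' hpos
    fun _ hu => polygonSum_inv_cosh_sub_cos_sq_lt hn hu hφ hφ'

theorem polygonSum_radial_lt_of_lt (hrs : r < s) :
    polygonSum n (fun x => (s * cos x - r) / cylDist r s d x ^ 3) φ' <
      polygonSum n (fun x => (s * cos x - r) / cylDist r s d x ^ 3) φ :=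
  polygonSum_div_cylDist_pow_lt (j := 1) hr hs hpos' hpos
    fun _ hu => polygonSum_radial_kernel_lt hn hu hφ hφ' hs hrs

end NewtonianSums

/-- For coplanar rings the distance `ρ` satisfies `2 r (s cos x - r) = (s² - r²) - ρ²`, which splits
the radial force into multiples of `∑ 1 / ρ³` and `∑ 1 / ρ`. -/
theorem polygonSum_radial_lt_of_gt {r s : ℝ} (hs : 0 < s) (hsr : s < r) {n : ℕ} {φ φ' : ℝ}
    (hpos : ∀ k < n, 0 < cylDist r s 0 (φ + 2 * π * k / n))
    (hpos' : ∀ k < n, 0 < cylDist r s 0 (φ' + 2 * π * k / n)) (hn : n ≠ 0)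
    (hφ : cos (n * φ) = 1) (hφ' : cos (n * φ') = -1) :
    polygonSum n (fun x => (s * cos x - r) / cylDist r s 0 x ^ 3) φ <
      polygonSum n (fun x => (s * cos x - r) / cylDist r s 0 x ^ 3) φ' := by
  have hr := hs.trans hsr
  have two_mul_radial {ψ : ℝ} (hψ : ∀ k < n, 0 < cylDist r s 0 (ψ + 2 * π * k / n)) :
      2 * r * polygonSum n (fun x => (s * cos x - r) / cylDist r s 0 x ^ 3) ψ =
        (s ^ 2 - r ^ 2) * polygonSum n (fun x => 1 / cylDist r s 0 x ^ 3) ψ -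
          polygonSum n (fun x => 1 / cylDist r s 0 x) ψ := by
    have term {x : ℝ} (hx : 0 < cylDist r s 0 x) :
        2 * r * ((s * cos x - r) / cylDist r s 0 x ^ 3) =
          (s ^ 2 - r ^ 2) * (1 / cylDist r s 0 x ^ 3) - 1 / cylDist r s 0 x := by
      field_simp
      linear_combination cylDist_sq r s 0 x
    rw [← polygonSum_const_mul, ← polygonSum_const_mul, ← polygonSum_sub]
    exact sum_congr rfl fun k hk => term (hψ k (mem_range.1 hk))
  have cube_lt := mul_lt_mul_of_neg_left
    (polygonSum_inv_cylDist_cube_lt hr hs hpos hpos' hn hφ hφ')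
    (sub_neg.2 (pow_lt_pow_left₀ hsr hs.le two_ne_zero))
  have inv_lt := polygonSum_inv_cylDist_lt hr hs hpos hpos' hn hφ hφ'
  refine lt_of_mul_lt_mul_left (a := 2 * r) ?_ (by positivity)
  rw [two_mul_radial hpos, two_mul_radial hpos']
  linarith

/-! ### Balance of two coaxial polygons -/

theorem eq_of_dvd_two_mul_of_dvd_two_mul {n p : ℕ} (hp : p ≠ 0) (h : n ∣ 2 * p) (h' : p ∣ 2 * n)
    (hne : n ≠ 2 * p) (hne' : p ≠ 2 * n) : n = p := by
  obtain ⟨c, hc⟩ := h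
  obtain ⟨d, hd⟩ := h'
  have mul_eq_four : c * d = 4 := by
    refine mul_left_cancel₀ hp ?_
    calc p * (c * d) = p * d * c := by ring
      _ = 2 * (n * c) := by rw [← hd, mul_assoc]
      _ = p * 4 := by rw [← hc]; ring
  have c_dvd : c ∣ 4 := ⟨d, mul_eq_four.symm⟩
  have c_le := Nat.le_of_dvd four_pos c_dvd
  interval_cases c <;> lia

theorem exists_eq_or_eq_of_sin_eq_zero {n : ℕ} (hn : n ≠ 0) {φ : ℝ} (h : sin (n * φ) = 0) :
    ∃ k : ℤ, φ = 2 * π * k / n ∨ φ = π / n + 2 * π * k / n := by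
  obtain ⟨i, hi⟩ := sin_eq_zero_iff.1 h
  have hn' : (n : ℝ) ≠ 0 := Nat.cast_ne_zero.2 hn
  obtain ⟨k, rfl | rfl⟩ := i.even_or_odd'
  · refine ⟨k, .inl ?_⟩
    push_cast at hi
    field_simp
    linear_combination -hi
  · refine ⟨k, .inr ?_⟩
    push_cast at hi
    field_simp
    linear_combination -hi

/-- A regular `n`-gon and a regular `p`-gon with a common axis have radii `r` and `s`; the `p`-gon
lies at height `d` above the `n`-gon and is turned by `φ` relative to it. The vertices of the
`n`-gon are balanced if the attraction of the `p`-gon on them has no tangential component and its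
radial and axial components are the same at all of them. The vertex `j` of the `n`-gon sees the
`p`-gon turned by `φ - 2 π j / n`. -/
structure IsBalancedPolygon (n p : ℕ) (r s d φ : ℝ) : Prop where
  dist_pos : ∀ j < n, ∀ k < p, 0 < cylDist r s d (φ - 2 * π * j / n + 2 * π * k / p)
  tangential : ∀ j < n,
    polygonSum p (fun x => sin x / cylDist r s d x ^ 3) (φ - 2 * π * j / n) = 0
  radial : ∃ R, ∀ j < n,
    polygonSum p (fun x => (s * cos x - r) / cylDist r s d x ^ 3) (φ - 2 * π * j / n) = R
  axial : ∃ Z, ∀ j < n,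
    d * polygonSum p (fun x => 1 / cylDist r s d x ^ 3) (φ - 2 * π * j / n) = Z

theorem exists_cos_add_two_pi_mul_div_eq_one {n : ℕ} (hn : n ≠ 0) {φ : ℝ} (h : cos (n * φ) = 1) :
    ∃ k < n, cos (φ + 2 * π * k / n) = 1 := by
  have prod_eq_zero := prod_two_mul_cosh_sub_cos hn 0 φ
  rw [mul_zero, cosh_zero, h, sub_self, mul_zero, prod_eq_zero_iff] at prod_eq_zero
  obtain ⟨k, hk, hcos⟩ := prod_eq_zero
  exact ⟨k, mem_range.1 hk, by linarith⟩

namespace IsBalancedPolygon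

variable {n p : ℕ} {r s d φ : ℝ}

theorem sin_mul_eq_zero (hr : 0 < r) (hs : 0 < s) (hp : p ≠ 0)
    (h : IsBalancedPolygon n p r s d φ) {j : ℕ} (hj : j < n) :
    sin (p * (φ - 2 * π * j / n)) = 0 :=
  sin_natCast_mul_eq_zero_of_polygonSum_eq_zero hr hs (h.dist_pos j hj) hp (h.tangential j hj)

theorem dvd_two_mul (hr : 0 < r) (hs : 0 < s) (hn : 2 ≤ n) (hp : p ≠ 0)
    (h : IsBalancedPolygon n p r s d φ) : n ∣ 2 * p := by
  obtain ⟨i, hi⟩ := sin_eq_zero_iff.1 (h.sin_mul_eq_zero hr hs hp (j := 0) (by lia))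
  obtain ⟨j, hj⟩ := sin_eq_zero_iff.1 (h.sin_mul_eq_zero hr hs hp (j := 1) (by lia))
  have hn' : (n : ℝ) ≠ 0 := Nat.cast_ne_zero.2 (by lia)
  have two_mul_eq : ((2 * p : ℕ) : ℝ) = n * (i - j) := by
    apply mul_right_cancel₀ pi_ne_zero
    push_cast at hi hj ⊢
    field_simp at hi hj
    linear_combination hj - hi
  exact Int.natCast_dvd_natCast.1 ⟨i - j, by exact_mod_cast two_mul_eq⟩

/-- Twice as many vertices as the other polygon: consecutive ones see it aligned and staggered. -/
theorem exists_aligned_staggered (hr : 0 < r) (hs : 0 < s) (hp : p ≠ 0)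
    (h : IsBalancedPolygon (2 * p) p r s d φ) :
    ∃ i < 2 * p, ∃ j < 2 * p, cos (p * (φ - 2 * π * i / (2 * p : ℕ))) = 1 ∧
      cos (p * (φ - 2 * π * j / (2 * p : ℕ))) = -1 := by
  have next_angle : p * (φ - 2 * π * (1 : ℕ) / (2 * p : ℕ)) =
      p * (φ - 2 * π * (0 : ℕ) / (2 * p : ℕ)) - π := by
    push_cast
    field_simp
    ring
  have cos_next : cos (p * (φ - 2 * π * (1 : ℕ) / (2 * p : ℕ))) =
      -cos (p * (φ - 2 * π * (0 : ℕ) / (2 * p : ℕ))) := by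
    rw [next_angle, cos_sub_pi]
  rcases sin_eq_zero_iff_cos_eq.1 (h.sin_mul_eq_zero hr hs hp (j := 0) (by lia)) with hc | hc
  · exact ⟨0, by lia, 1, by lia, hc, by rw [cos_next, hc]⟩
  · exact ⟨1, by lia, 0, by lia, by rw [cos_next, hc, neg_neg], hc⟩

theorem ne_two_mul (hr : 0 < r) (hs : 0 < s) (hp : p ≠ 0) (h : IsBalancedPolygon n p r s d φ) :
    n ≠ 2 * p := by
  rintro rfl
  obtain ⟨i, hi, j, hj, aligned, staggered⟩ := h.exists_aligned_staggered hr hs hp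
  have hpos := h.dist_pos i hi
  have hpos' := h.dist_pos j hj
  rcases ne_or_eq d 0 with hd | rfl
  · obtain ⟨Z, hZ⟩ := h.axial
    exact (polygonSum_inv_cylDist_cube_lt hr hs hpos hpos' hp aligned staggered).ne'
      (mul_left_cancel₀ hd ((hZ i hi).trans (hZ j hj).symm))
  obtain ⟨R, hR⟩ := h.radial
  have radial_eq := (hR i hi).trans (hR j hj).symm
  rcases lt_trichotomy r s with hrs | rfl | hsr
  · exact (polygonSum_radial_lt_of_lt hr hs hpos hpos' hp aligned staggered hrs).ne' radial_eq
  · obtain ⟨k, hk, hcos⟩ := exists_cos_add_two_pi_mul_div_eq_one hp aligned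
    have sq_pos := pow_pos (hpos k hk) 2
    rw [cylDist_sq, hcos] at sq_pos
    linarith
  · exact (polygonSum_radial_lt_of_gt hs hsr hpos hpos' hp aligned staggered).ne radial_eq

end IsBalancedPolygon

/-! ### The equations of motion in cylindrical coordinates -/

/-- The point with cylindrical coordinates `(r, α, z)`. -/
noncomputable def cylPoint (r α z : ℝ) : EuclideanSpace ℝ (Fin 3) :=
  !₂[r * cos α, r * sin α, z]

theorem inner_cylPoint (r α z s β w : ℝ) :
    inner ℝ (cylPoint r α z) (cylPoint s β w) = r * s * cos (α - β) + z * w := by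
  simp only [cylPoint, PiLp.inner_apply, Fin.sum_univ_three, RCLike.inner_apply, conj_trivial,
    Matrix.cons_val, cos_sub]
  ring

theorem norm_cylPoint_sub_cylPoint (r α z s β w : ℝ) :
    ‖cylPoint s β w - cylPoint r α z‖ = cylDist r s (w - z) (β - α) := by
  rw [← sq_eq_sq₀ (norm_nonneg _) (cylDist_nonneg ..), norm_sub_sq_real, cylDist_sq,
    ← real_inner_self_eq_norm_sq, ← real_inner_self_eq_norm_sq]
  simp only [inner_cylPoint, sub_self, cos_zero]
  ring

/-- The vertices of the regular `n`-gon of radius `r` about the `z`-axis at height `z` whose first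
vertex has polar angle `α`. -/
noncomputable def regularPolygon (n : ℕ) (r α z : ℝ) (k : Fin n) : EuclideanSpace ℝ (Fin 3) :=
  cylPoint r (2 * π * k / n + α) z

/-- The force is tested against `cylPoint c (α + δ) e`: the choices `(1, π / 2, 0)`, `(1, 0, 0)`
and `(0, 0, 1)` of `(c, δ, e)` give the tangential, radial and axial component at
`cylPoint r α z`. -/
theorem inner_sum_regularPolygon_smul_sub (p : ℕ) (M r α z s β w c δ e : ℝ) :
    inner ℝ (∑ k, (M / ‖regularPolygon p s β w k - cylPoint r α z‖ ^ 3) •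
        (regularPolygon p s β w k - cylPoint r α z)) (cylPoint c (α + δ) e) =
      M * polygonSum p (fun x => (c * (s * cos (x - δ) - r * cos δ) + e * (w - z)) /
        cylDist r s (w - z) x ^ 3) (β - α) := by
  rw [← polygonSum_const_mul, ← sum_fin_eq_polygonSum, sum_inner]
  refine sum_congr rfl fun k _ => ?_
  rw [regularPolygon, norm_cylPoint_sub_cylPoint, inner_smul_left, inner_sub_left, inner_cylPoint,
    inner_cylPoint, sub_add_cancel_left, cos_neg]
  simp only [conj_trivial, ← sub_sub]
  ring

namespace IsCentralConfiguration

section Reindex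

variable {ι κ : Type*} [Fintype ι] [DecidableEq ι] [Fintype κ] [DecidableEq κ] {m : ι → ℝ}
  {q : ι → EuclideanSpace ℝ (Fin 3)}

theorem comp_equiv (h : IsCentralConfiguration m q) (e : κ ≃ ι) :
    IsCentralConfiguration (m ∘ e) (q ∘ e) := by
  obtain ⟨sum_eq_zero, q_ne, lam, force⟩ := h
  refine ⟨?_, fun j k hjk => q_ne _ _ (e.injective.ne hjk), lam, fun k => ?_⟩
  · rw [← sum_eq_zero, ← e.sum_comp]
    rfl
  · rw [Function.comp_apply, Function.comp_apply, ← force (e k)]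
    exact sum_equiv e (by simp) fun _ _ => rfl

theorem exists_sum_smul_sub_eq_smul (hm : ∀ i, m i ≠ 0) (h : IsCentralConfiguration m q) :
    ∃ lam : ℝ, ∀ i, ∑ j, (m j / ‖q j - q i‖ ^ 3) • (q j - q i) = lam • q i := by
  obtain ⟨-, -, lam, force⟩ := h
  refine ⟨-lam, fun i => smul_right_injective _ (hm i) ?_⟩
  have := force i
  rw [sum_erase _ (by simp)] at this
  simp only [smul_sum, smul_smul]
  convert this using 3 <;> ring

end Reindex

variable {n p : ℕ} {μ M r s α β z w : ℝ}

theorem exists_polygonSum_eq (hμ : μ ≠ 0) (hM : M ≠ 0)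
    (h : IsCentralConfiguration (Sum.elim (fun _ => μ) fun _ => M)
      (Sum.elim (regularPolygon n r α z) (regularPolygon p s β w))) :
    ∃ lam : ℝ, ∀ j < n, ∀ c δ e,
      μ * polygonSum n (fun x => c * (r * cos (x - δ) - r * cos δ) / cylDist r r 0 x ^ 3) 0 +
        M * polygonSum p (fun x => (c * (s * cos (x - δ) - r * cos δ) + e * (w - z)) /
          cylDist r s (w - z) x ^ 3) (β - α - 2 * π * j / n) =
      lam * (c * r * cos δ + e * z) := by
  obtain ⟨lam, force⟩ := h.exists_sum_smul_sub_eq_smul (Sum.rec (fun _ => hμ) fun _ => hM)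
  refine ⟨lam, fun j hj c δ e => ?_⟩
  have component := congrArg (inner ℝ · (cylPoint c (2 * π * j / n + α + δ) e))
    (force (.inl ⟨j, hj⟩))
  have angle (γ : ℝ) : γ - (2 * π * j / n + α) = γ - α - 2 * π * j / n := by ring
  have periodic : Function.Periodic
      (fun x => c * (r * cos (x - δ) - r * cos δ) / cylDist r r 0 x ^ 3) (2 * π) := fun x => by
    simp only [cylDist_periodic r r 0 x, add_sub_right_comm x, cos_add_two_pi]
  simp only [Fintype.sum_sum_type, Sum.elim_inl, Sum.elim_inr, inner_add_left,
    regularPolygon.eq_1 n r α z ⟨j, hj⟩, inner_sum_regularPolygon_smul_sub, inner_smul_left,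
    inner_cylPoint, angle, sub_self, mul_zero, add_zero, polygonSum_sub_mul_div n periodic]
    at component
  simpa [sub_add_cancel_left, mul_comm r c, mul_comm z e] using component

theorem isBalancedPolygon (hμ : μ ≠ 0) (hM : M ≠ 0) (hs : s ≠ 0)
    (h : IsCentralConfiguration (Sum.elim (fun _ => μ) fun _ => M)
      (Sum.elim (regularPolygon n r α z) (regularPolygon p s β w))) :
    IsBalancedPolygon n p r s (w - z) (β - α) := by
  obtain ⟨lam, balance⟩ := h.exists_polygonSum_eq hμ hM
  refine ⟨fun j hj k hk => ?_, fun j hj => ?_, ?_, ?_⟩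
  · have ne := h.2.1 (.inr ⟨k, hk⟩) (.inl ⟨j, hj⟩) Sum.inr_ne_inl
    have norm_pos := norm_pos_iff.2 (sub_ne_zero.2 ne)
    rw [Sum.elim_inl, Sum.elim_inr, regularPolygon, regularPolygon,
      norm_cylPoint_sub_cylPoint] at norm_pos
    convert! norm_pos using 2
    ring
  · have own : polygonSum n (fun x => sin x / cylDist r r 0 x ^ 3) 0 = 0 :=
      polygonSum_zero_of_odd n
        (fun x => by rw [sin_add_two_pi, cylDist_periodic])
        (fun x => by rw [sin_neg, cylDist_neg, neg_div])
    have tangential := balance j hj 1 (π / 2) 0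
    simp only [cos_sub_pi_div_two, cos_pi_div_two, mul_zero, sub_zero, one_mul, zero_mul, add_zero,
      zero_add, mul_div_assoc s, mul_div_assoc r, polygonSum_const_mul, own] at tangential
    exact (mul_eq_zero.1 ((mul_eq_zero.1 tangential).resolve_left hM)).resolve_left hs
  · refine ⟨(lam * r - μ * polygonSum n (fun x => (r * cos x - r) / cylDist r r 0 x ^ 3) 0) / M,
      fun j hj => eq_div_of_mul_eq hM (eq_sub_of_add_eq' ?_)⟩
    simpa only [sub_zero, cos_zero, mul_one, one_mul, zero_mul, add_zero, mul_comm _ M]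
      using balance j hj 1 0 0
  · refine ⟨lam * z / M, fun j hj => eq_div_of_mul_eq hM ?_⟩
    have axial := balance j hj 0 0 1
    simp only [zero_mul, zero_add, zero_div, one_mul, ← mul_one_div (w - z),
      polygonSum_const_mul _ (w - z)] at axial
    simpa [polygonSum, mul_comm _ M] using axial

end IsCentralConfiguration

theorem cylPoint_sub_cylPoint_zero (r α z ζ : ℝ) :
    cylPoint r α z - cylPoint 0 0 ζ = cylPoint r α (z - ζ) := by
  ext i
  fin_cases i <;> simp [cylPoint]

theorem twoPolygonMass_eq_sumElim (N L : ℕ) (m b : ℝ) :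
    twoPolygonMass N L m b = Sum.elim (fun _ => m) fun _ => b * m := by
  ext (_ | _) <;> rfl

theorem sum_regularPolygon {n : ℕ} (hn : 2 ≤ n) (r α z : ℝ) :
    ∑ k, regularPolygon n r α z k = cylPoint 0 0 (n * z) := by
  have cos_sum := sum_fin_eq_polygonSum n cos α 0
  have sin_sum := sum_fin_eq_polygonSum n cos α (π / 2)
  simp only [polygonSum_cos hn, sub_zero, cos_sub_pi_div_two] at cos_sum sin_sum
  ext i
  fin_cases i <;> simp [regularPolygon, cylPoint, ← mul_sum, cos_sum, sin_sum]

theorem exists_centerMass_eq_cylPoint_zero {n p : ℕ} (hn : 2 ≤ n) (hp : 2 ≤ p)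
    (μ M r s α β z w : ℝ) :
    ∃ ζ, univ.centerMass (Sum.elim (fun _ => μ) fun _ => M)
      (Sum.elim (regularPolygon n r α z) (regularPolygon p s β w)) = cylPoint 0 0 ζ := by
  refine ⟨(n * μ + p * M)⁻¹ * (μ * (n * z) + M * (p * w)), ?_⟩
  simp only [centerMass, Fintype.sum_sum_type, Sum.elim_inl, Sum.elim_inr, ← smul_sum,
    sum_regularPolygon hn, sum_regularPolygon hp]
  ext i
  fin_cases i <;> simp [cylPoint, mul_add]

theorem twoPolygonVertex_eq_sumElim (N L : ℕ) (a h θ : ℝ) :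
    twoPolygonVertex N L a h θ = Sum.elim (regularPolygon N 1 0 0) (regularPolygon L a θ h) := by
  ext1 (k | l)
  · simp [twoPolygonVertex, regularPolygon, cylPoint]
  · rfl

theorem exists_twoPolygonConfig_eq_sumElim {N L : ℕ} (hN : 2 ≤ N) (hL : 2 ≤ L)
    (m b a h θ : ℝ) :
    ∃ ζ, twoPolygonConfig N L m b a h θ =
      Sum.elim (regularPolygon N 1 0 (0 - ζ)) (regularPolygon L a θ (h - ζ)) := by
  obtain ⟨ζ, center⟩ := exists_centerMass_eq_cylPoint_zero hN hL m (b * m) 1 a 0 θ 0 h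
  refine ⟨ζ, ?_⟩
  ext1 i
  rw [twoPolygonConfig, twoPolygonMass_eq_sumElim, twoPolygonVertex_eq_sumElim, center]
  rcases i with k | l <;> exact cylPoint_sub_cylPoint_zero ..

theorem theorem1p6_general {n p : ℕ} (hn : 2 ≤ n) (hp : 2 ≤ p) {μ M r s α β z w : ℝ}
    (hμ : μ ≠ 0) (hM : M ≠ 0) (hr : 0 < r) (hs : 0 < s)
    (hcc : IsCentralConfiguration (Sum.elim (fun _ => μ) fun _ => M)
      (Sum.elim (regularPolygon n r α z) (regularPolygon p s β w))) :
    n = p ∧ ∃ k : ℤ, β - α = 2 * π * k / n ∨ β - α = π / n + 2 * π * k / n := by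
  have hn' : n ≠ 0 := by lia
  have hp' : p ≠ 0 := by lia
  have swapped : IsCentralConfiguration (Sum.elim (fun _ => M) fun _ => μ)
      (Sum.elim (regularPolygon p s β w) (regularPolygon n r α z)) := by
    simpa only [Equiv.sumComm_apply, Sum.elim_swap] using hcc.comp_equiv (Equiv.sumComm _ _)
  have lower := hcc.isBalancedPolygon hμ hM hs.ne'
  have upper := swapped.isBalancedPolygon hM hμ hr.ne'
  obtain rfl : n = p := eq_of_dvd_two_mul_of_dvd_two_mul hp' (lower.dvd_two_mul hr hs hn hp')
    (upper.dvd_two_mul hs hr hp hn') (lower.ne_two_mul hr hs hp') (upper.ne_two_mul hs hr hn')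
  refine ⟨rfl, exists_eq_or_eq_of_sin_eq_zero hn' ?_⟩
  simpa using lower.sin_mul_eq_zero hr hs hn' (j := 0) (by lia)

theorem theorem1p6 (N L : ℕ) (hN : 2 ≤ N) (hNL : N ≤ L) (m b a h θ : ℝ)
    (hm : 0 < m) (hb : 0 < b) (ha : 0 < a) (hh : 0 ≤ h)
    (hcc : IsCentralConfiguration (twoPolygonMass N L m b) (twoPolygonConfig N L m b a h θ)) :
    N = L ∧ ∃ k : ℤ, θ = 2 * Real.pi * k / N ∨ θ = Real.pi / N + 2 * Real.pi * k / N := by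
  obtain ⟨ζ, config_eq⟩ := exists_twoPolygonConfig_eq_sumElim hN (hN.trans hNL) m b a h θ
  rw [twoPolygonMass_eq_sumElim, config_eq] at hcc
  simpa using theorem1p6_general hN (hN.trans hNL) hm.ne' (by positivity) one_pos ha hcc
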